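/- There is a universal constant $c_0>0$ such that the following holds. Let $d\ge 2$ be an integer, $\rho\in\mathbb{R}$, $\delta\in(0,1/4)$, $0<\epsilon\le |\rho|/2048$, $\sigma>0$ and $T\in\mathbb{N}$. For a matrix $A\in\mathbb{R}^{d\times d}$ let $\Pr_A$ denote the law of the trajectory $(X_1,\dots,X_{T+1})$ of the linear system $X_{t+1}=AX_t+\eta_t$, $X_0=0$, with noise $\eta_0,\eta_1,\dots$ i.i.d. $\mathcal{N}(0,\sigma^2 I_d)$, and let $\gamma_T(\rho)=\sum_{s=0}^{T-1}|\rho|^{2s}$. If $$T\,\gamma_T(\rho)\le \frac{c_0\,(d+\log(1/\delta))}{\epsilon^2},$$ then for every estimator $\widehat A(T)$, that is, every measurable function of $(X_1,\dots,X_{T+1})$ with values in $\mathbb{R}^{d\times d}$, $$\sup_{O\in \mathrm{O}(d)}\Pr_{\rho O}\Big[\big\|\widehat A(T)-\rho O\big\|_{\mathrm{op}}\ge \epsilon\Big]\ge \delta,$$ where $\mathrm{O}(d)$ is the group of orthogonal $d\times d$ real matrices and $\|\cdot\|_{\mathrm{op}}$ is the operator norm with respect to the Euclidean norm. -/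

import Mathlib

open MeasureTheory ProbabilityTheory

noncomputable section

namespace LDS

/-- The state space `ℝ^d` with its Euclidean norm. -/
abbrev State (d : ℕ) : Type := EuclideanSpace ℝ (Fin d)

/-- The operator norm of a real `d × d` matrix with respect to the Euclidean norm on `ℝ^d`. -/
def opNorm {d : ℕ} (A : Matrix (Fin d) (Fin d) ℝ) : ℝ :=
  ‖Matrix.toEuclideanCLM (n := Fin d) (𝕜 := ℝ) A‖

/-- The state `X_t` of the linear system `X_{t+1} = A X_t + η_t`, `X_0 = 0`,
driven by the noise sequence `η`. -/
def state {d : ℕ} (A : Matrix (Fin d) (Fin d) ℝ) (η : ℕ → State d) : ℕ → State d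
  | 0 => 0
  | t + 1 => Matrix.toEuclideanCLM (n := Fin d) (𝕜 := ℝ) A (state A η t) + η t

/-- The observed trajectory `(X_1, …, X_{T+1})`. -/
def trajectory {d : ℕ} (A : Matrix (Fin d) (Fin d) ℝ) (T : ℕ) (η : ℕ → State d) :
    Fin (T + 1) → State d :=
  fun i => state A η (i + 1)

/-- The law of an i.i.d. noise sequence `η_0, η_1, …` with `η_t ∼ N(0, σ² I_d)`. -/
def noiseLaw (d : ℕ) (σ : ℝ) : Measure (ℕ → State d) :=
  Measure.infinitePi fun _ : ℕ =>
    multivariateGaussian (0 : State d) (σ ^ 2 • (1 : Matrix (Fin d) (Fin d) ℝ))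

/-- The law `P_A` of the observed trajectory `(X_1, …, X_{T+1})` of the linear system
`X_{t+1} = A X_t + η_t`, `X_0 = 0`, with i.i.d. noise `η_t ∼ N(0, σ² I_d)`. -/
def trajectoryLaw {d : ℕ} (σ : ℝ) (A : Matrix (Fin d) (Fin d) ℝ) (T : ℕ) :
    Measure (Fin (T + 1) → State d) :=
  (noiseLaw d σ).map (trajectory A T)

/-- The trajectory is a measurable function of the noise, so the image measure above is
the genuine law. -/
theorem measurable_trajectory {d : ℕ} (A : Matrix (Fin d) (Fin d) ℝ) (T : ℕ) :
    Measurable (trajectory A T) := by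
  have h : ∀ t : ℕ, Measurable fun η : ℕ → State d => state A η t := by
    intro t
    induction t with
    | zero => exact measurable_const
    | succ t ih =>
      exact ((ContinuousLinearMap.measurable _).comp ih).add (measurable_pi_apply t)
  exact measurable_pi_lambda _ fun i => h _

/-- The scalar Gramian `γ_t(ρ) = ∑_{s=0}^{t-1} |ρ|^{2s}`. -/
def scalarGramian (t : ℕ) (ρ : ℝ) : ℝ :=
  ∑ s ∈ Finset.range t, |ρ| ^ (2 * s)

end LDS

end

noncomputable section

namespace LDS

open scoped NNReal ENNReal


/-! The lower bound compares one base system with a cube of nearby alternatives. With `e` the first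
basis vector, the base is `ρ H_e`, and each sign vector `v` gives an alternative `ρ H_u`, where `H`
is a Householder reflection and `u = (c, s v / √n)`, `n = d - 1`, is a unit vector at distance of
order `s = 2ε/|ρ|` from `e`.

If every error probability is below `δ < 1/4`, the estimator succeeds with probability at least
`3/4` under each alternative. By Girsanov (`lintegral_trajectory_sub`) the likelihood ratio of base
to alternative is `exp(-(M + Q/2))`, with `M` a martingale and `Q` its quadratic variation. The
difference `D` of the two matrices has rank at most two and the states have isotropic covariance, so
`Q` has mean `O(T γ_T ε²)` without a factor `d`. Bounding `M` and `Q` with high probability keeps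
each success event at base probability at least `exp(-O(T γ_T ε²) - O(1))` (`le_trajectoryLaw_sub`).

Two obstructions contradict this. Success at an alternative is an error at the base, so the
probability is below `δ`. Moreover, one estimate can succeed only for sign vectors strongly
correlated with one another, a fraction at most `exp(-n/8)` of the cube; averaging over `v` bounds
the smallest probability by `exp(-n/8)` (`exists_trajectoryLaw_goodEvent_le`). The first settles
large `log(1/δ)`, the second large `d`. -/

/-- The law of a single noise vector. -/
abbrev noise (d : ℕ) (σ : ℝ) : Measure (State d) :=
  multivariateGaussian (0 : State d) (σ ^ 2 • (1 : Matrix (Fin d) (Fin d) ℝ))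

/-! ### Isotropic Gaussian: product form, translation, second moments. -/

lemma posSemidef_sq_smul_one (d : ℕ) (σ : ℝ) :
    (σ ^ 2 • (1 : Matrix (Fin d) (Fin d) ℝ)).PosSemidef :=
  Matrix.PosSemidef.one.smul (sq_nonneg σ)

lemma noise_eq_map_pi (d : ℕ) (σ : ℝ) :
    noise d σ = (Measure.pi fun _ : Fin d => gaussianReal 0 (σ ^ 2).toNNReal).map
      (WithLp.toLp 2) := by
  apply Measure.ext_of_charFun (E := State d)
  ext t
  rw [charFun_multivariateGaussian (posSemidef_sq_smul_one d σ)]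
  simp_rw [charFun_pi, charFun_gaussianReal, ← Complex.exp_sum]
  congr 1
  simp [Matrix.smul_mulVec, dotProduct, Finset.sum_div, sq_nonneg]
  refine Finset.sum_congr rfl fun i _ => by ring

lemma gaussianReal_eq_withDensity_zero (b : ℝ) {v : ℝ≥0} (hv : v ≠ 0) :
    gaussianReal b v = (gaussianReal 0 v).withDensity
      fun x => ENNReal.ofReal (Real.exp (b * x / v - b ^ 2 / (2 * v))) := by
  rw [gaussianReal_of_var_ne_zero _ hv, gaussianReal_of_var_ne_zero _ hv,
    ← withDensity_mul _ (measurable_gaussianPDF _ _) (by fun_prop)]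
  congr 1
  ext x
  have hv' : (v : ℝ) ≠ 0 := by exact_mod_cast hv
  rw [Pi.mul_apply, gaussianPDF, gaussianPDF, ← ENNReal.ofReal_mul (gaussianPDFReal_nonneg _ _ _),
    gaussianPDFReal, gaussianPDFReal, mul_assoc _ (Real.exp _) (Real.exp _), ← Real.exp_add]
  congr 4
  field_simp
  ring

lemma pi_withDensity {ι : Type*} [Fintype ι] {Ω : ι → Type*} [∀ i, MeasurableSpace (Ω i)]
    (μ : ∀ i, Measure (Ω i)) [∀ i, IsProbabilityMeasure (μ i)] {f : ∀ i, Ω i → ℝ≥0∞}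
    (hf : ∀ i, Measurable (f i)) [∀ i, SigmaFinite ((μ i).withDensity (f i))] :
    Measure.pi (fun i => (μ i).withDensity (f i)) =
      (Measure.pi μ).withDensity fun x => ∏ i, f i (x i) := by
  refine Measure.pi_eq fun s hs => ?_
  rw [withDensity_apply _ (MeasurableSet.univ_pi hs), ← lintegral_indicator (MeasurableSet.univ_pi hs)]
  have h1 : ∀ x : ∀ i, Ω i, (Set.univ.pi s).indicator (fun x => ∏ i, f i (x i)) x =
      ∏ i, (s i).indicator (f i) (x i) := by
    intro x
    by_cases hx : x ∈ Set.univ.pi s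
    · rw [Set.indicator_of_mem hx]
      exact Finset.prod_congr rfl fun i _ => by rw [Set.indicator_of_mem (hx i trivial)]
    · rw [Set.indicator_of_notMem hx]
      simp only [Set.mem_pi, Set.mem_univ, true_imp_iff, not_forall] at hx
      obtain ⟨i, hi⟩ := hx
      exact (Finset.prod_eq_zero (Finset.mem_univ i) (Set.indicator_of_notMem hi _)).symm
  simp_rw [h1]
  rw [lintegral_prod_eq_prod_lintegral_of_indepFun Finset.univ
    (fun i (x : ∀ i, Ω i) => (s i).indicator (f i) (x i))
    (iIndepFun_pi fun i => ((hf i).indicator (hs i)).aemeasurable)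
    (fun i => ((hf i).indicator (hs i)).comp (measurable_pi_apply i))]
  refine Finset.prod_congr rfl fun i _ => ?_
  rw [(measurePreserving_eval μ i).lintegral_comp ((hf i).indicator (hs i)),
    lintegral_indicator (hs i), withDensity_apply _ (hs i)]

/-- The Cameron–Martin formula for the isotropic Gaussian law on `ℝ^d`. -/
lemma lintegral_noise_add {d : ℕ} {σ : ℝ} (hσ : 0 < σ) (b : State d) {f : State d → ℝ≥0∞}
    (hf : Measurable f) :
    ∫⁻ y, f (b + y) ∂noise d σ =
      ∫⁻ y, f y * ENNReal.ofReal (Real.exp ((inner ℝ b y - ‖b‖ ^ 2 / 2) / σ ^ 2)) ∂noise d σ := by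
  have hv : (σ ^ 2).toNNReal ≠ 0 := by simpa using hσ.ne'
  have hm : Measurable (WithLp.toLp 2 : (Fin d → ℝ) → State d) := by fun_prop
  have hf' : Measurable fun x : Fin d → ℝ => f (WithLp.toLp 2 x) := hf.comp hm
  rw [noise_eq_map_pi, lintegral_map (by fun_prop) hm, lintegral_map (by fun_prop) hm]
  have h1 : (Measure.pi fun _ : Fin d => gaussianReal 0 (σ ^ 2).toNNReal).map
      (fun x i => x i + b i) = Measure.pi fun i => gaussianReal (b i) (σ ^ 2).toNNReal := by
    rw [Measure.pi_map_pi (f := fun i x => x + b i) (fun i => by fun_prop)]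
    simp_rw [gaussianReal_map_add_const, zero_add]
  have h2 : ∫⁻ y, f (b + WithLp.toLp 2 y) ∂(Measure.pi fun _ : Fin d =>
      gaussianReal 0 (σ ^ 2).toNNReal) = ∫⁻ y, f (WithLp.toLp 2 y) ∂(Measure.pi fun i : Fin d =>
      gaussianReal (b i) (σ ^ 2).toNNReal) := by
    rw [← h1, lintegral_map hf' (by fun_prop)]
    refine lintegral_congr fun y => ?_
    congr 1
    ext i
    simp [add_comm]
  have h3 : (fun i : Fin d => gaussianReal (b i) (σ ^ 2).toNNReal) = fun i =>
      (gaussianReal 0 (σ ^ 2).toNNReal).withDensity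
      fun x => ENNReal.ofReal (Real.exp (b i * x / (σ ^ 2).toNNReal -
        b i ^ 2 / (2 * (σ ^ 2).toNNReal))) :=
    funext fun i => gaussianReal_eq_withDensity_zero _ hv
  have : ∀ i : Fin d, SigmaFinite ((gaussianReal 0 (σ ^ 2).toNNReal).withDensity
      fun x => ENNReal.ofReal (Real.exp (b i * x / (σ ^ 2).toNNReal -
        b i ^ 2 / (2 * (σ ^ 2).toNNReal)))) := by
    intro i
    rw [← gaussianReal_eq_withDensity_zero _ hv]
    infer_instance
  rw [h2, h3, pi_withDensity _ (fun i => by fun_prop),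
    lintegral_withDensity_eq_lintegral_mul _ (by fun_prop) hf']
  refine lintegral_congr fun y => ?_
  rw [Pi.mul_apply, mul_comm]
  congr 1
  rw [← ENNReal.ofReal_prod_of_nonneg (fun i _ => (Real.exp_pos _).le), ← Real.exp_sum]
  congr 2
  have h4 : ((σ ^ 2).toNNReal : ℝ) = σ ^ 2 := Real.coe_toNNReal _ (sq_nonneg σ)
  rw [h4, EuclideanSpace.real_norm_sq_eq, PiLp.inner_apply, Finset.sum_div, ← Finset.sum_sub_distrib,
    Finset.sum_div]
  refine Finset.sum_congr rfl fun i _ => ?_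
  simp
  field_simp

lemma lintegral_noise_inner_add_sq {d : ℕ} {σ : ℝ} (w : State d) (a : ℝ) :
    ∫⁻ y, ENNReal.ofReal ((a + inner ℝ w y) ^ 2) ∂noise d σ =
      ENNReal.ofReal (a ^ 2 + σ ^ 2 * ‖w‖ ^ 2) := by
  have hL2 : MemLp (fun y : State d => inner ℝ w y) 2 (noise d σ) :=
    (innerSL ℝ w).comp_memLp' IsGaussian.memLp_two_id
  have hint : Integrable (fun y : State d => inner ℝ w y) (noise d σ) := hL2.integrable (by simp)
  have hmean : ∫ y, inner ℝ w y ∂noise d σ = 0 := by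
    have := (innerSL ℝ w).integral_comp_comm (μ := noise d σ) (φ := id) IsGaussian.integrable_id
    simpa using this
  have hvar : ∫ y, (inner ℝ w y) ^ 2 ∂noise d σ = σ ^ 2 * ‖w‖ ^ 2 := by
    have h1 := covarianceBilin_apply_eq_cov (μ := noise d σ) IsGaussian.memLp_two_id w w
    rw [covarianceBilin_multivariateGaussian (posSemidef_sq_smul_one d σ),
      covariance_self hL2.aemeasurable, variance_of_integral_eq_zero hL2.aemeasurable hmean] at h1
    rw [← h1, EuclideanSpace.real_norm_sq_eq]
    simp [Matrix.smul_mulVec, dotProduct, Finset.mul_sum]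
    exact Finset.sum_congr rfl fun i _ => by ring
  have hint2 : Integrable (fun y : State d => (inner ℝ w y) ^ 2) (noise d σ) := hL2.integrable_sq
  rw [← ofReal_integral_eq_lintegral_ofReal]
  · congr 1
    simp_rw [add_sq]
    rw [integral_add (by fun_prop) hint2, integral_add (by fun_prop) (by fun_prop),
      integral_const_mul, hmean, hvar]
    simp
  · simp_rw [add_sq]
    fun_prop
  · exact ae_of_all _ fun y => sq_nonneg _


/-! ### Independence of the current noise from the past. -/

section Noise

variable {d : ℕ} {σ : ℝ}

instance isProbabilityMeasure_noiseLaw : IsProbabilityMeasure (noiseLaw d σ) := by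
  unfold noiseLaw
  infer_instance

/-- Integrating out the noise at time `t` against a quantity depending only on the past. -/
lemma lintegral_noiseLaw_past {Y : Type*} [MeasurableSpace Y] (t : ℕ)
    {g : (ℕ → State d) → Y} (hg : Measurable g)
    (hpast : ∀ η η' : ℕ → State d, (∀ s < t, η s = η' s) → g η = g η')
    {F : Y → State d → ℝ≥0∞} (hF : Measurable (Function.uncurry F)) :
    ∫⁻ η, F (g η) (η t) ∂noiseLaw d σ =
      ∫⁻ η, ∫⁻ y, F (g η) y ∂noise d σ ∂noiseLaw d σ := by
  -- Padding with zeros makes `g` factor through the first `t` coordinates; the padding value is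
  -- irrelevant by `hpast`.
  let extend : (Finset.range t → State d) → ℕ → State d :=
    fun x s => if h : s ∈ Finset.range t then x ⟨s, h⟩ else 0
  have hextend : Measurable extend := by
    refine measurable_pi_lambda _ fun s => ?_
    by_cases h : s ∈ Finset.range t
    · simp only [extend, h, dif_pos]
      exact measurable_pi_apply (⟨s, h⟩ : Finset.range t)
    · simp only [extend, h, dif_neg, not_false_eq_true]
      exact measurable_const
  have hindep : IndepFun g (fun η => η t) (noiseLaw d σ) := by
    have hlast : Measurable fun x : ({t} : Finset ℕ) → State d =>
        x ⟨t, Finset.mem_singleton_self t⟩ := measurable_pi_apply _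
    have h := (iIndepFun_infinitePi (P := fun _ : ℕ => noise d σ)
      (X := fun _ x => x) (fun _ => measurable_id)).indepFun_finset
      (Finset.range t) {t} (by simp) (fun i => measurable_pi_apply i)
    have h' := h.comp (φ := g ∘ extend) (ψ := fun x => x ⟨t, Finset.mem_singleton_self t⟩)
      (hg.comp hextend) hlast
    convert! h' using 1
    ext η
    exact hpast _ _ fun s hs => by simp [extend, hs]
  have hmap := hindep.map_prod_eq_prod_map_map hg.aemeasurable (measurable_pi_apply t).aemeasurable
  have heval : (noiseLaw d σ).map (fun η => η t) = noise d σ :=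
    Measure.infinitePi_map_eval (fun _ : ℕ => noise d σ) t
  have hpair : Measurable fun η : ℕ → State d => (g η, η t) := hg.prodMk (measurable_pi_apply t)
  calc ∫⁻ η, F (g η) (η t) ∂noiseLaw d σ
      = ∫⁻ p, Function.uncurry F p ∂((noiseLaw d σ).map fun η => (g η, η t)) :=
        (lintegral_map hF hpair).symm
    _ = ∫⁻ x, ∫⁻ y, F x y ∂noise d σ ∂((noiseLaw d σ).map g) := by
        rw [hmap, heval, lintegral_prod _ hF.aemeasurable]
        rfl
    _ = _ := lintegral_map hF.lintegral_prod_right' hg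

end Noise

/-! ### Recursive structure of trajectories. -/

section Trajectory

variable {d : ℕ} (A : Matrix (Fin d) (Fin d) ℝ)

lemma state_succ (η : ℕ → State d) (t : ℕ) :
    state A η (t + 1) = Matrix.toEuclideanCLM (n := Fin d) (𝕜 := ℝ) A (state A η t) + η t := rfl

lemma state_congr {t : ℕ} {η η' : ℕ → State d} (h : ∀ s < t, η s = η' s) :
    state A η t = state A η' t := by
  induction t with
  | zero => rfl
  | succ t ih => rw [state_succ, state_succ, ih fun s hs => h s (by omega), h t (by omega)]

@[fun_prop]
lemma measurable_state (t : ℕ) : Measurable fun η : ℕ → State d => state A η t := by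
  induction t with
  | zero => exact measurable_const
  | succ t ih => exact ((ContinuousLinearMap.measurable _).comp ih).add (measurable_pi_apply t)

lemma trajectory_congr {T : ℕ} {η η' : ℕ → State d} (h : ∀ s < T + 1, η s = η' s) :
    trajectory A T η = trajectory A T η' :=
  funext fun i => state_congr A fun s hs => h s (by omega)

lemma trajectory_succ (T : ℕ) (η : ℕ → State d) :
    trajectory A (T + 1) η = Fin.snoc (α := fun _ => State d) (trajectory A T η)
      (Matrix.toEuclideanCLM (n := Fin d) (𝕜 := ℝ) A (trajectory A T η (Fin.last T)) +
        η (T + 1)) := by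
  ext1 i
  refine Fin.lastCases ?_ (fun j => ?_) i
  · simp [trajectory, state_succ]
  · simp [trajectory]

lemma measurable_snoc (T : ℕ) : Measurable fun p : (Fin (T + 1) → State d) × State d =>
    (Fin.snoc (α := fun _ => State d) p.1 p.2 : Fin (T + 2) → State d) := by
  refine measurable_pi_lambda _ fun i => ?_
  refine Fin.lastCases ?_ (fun j => ?_) i
  · simpa using measurable_snd
  · simpa using! (measurable_pi_apply j).comp measurable_fst

end Trajectory

/-! ### Likelihood ratio of two linear systems. -/

section Likelihood

variable {d : ℕ}

/-- The normalized stochastic integral `∑ ⟪D X_t, η_t⟫ / σ²` along the system with matrix `A`. -/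
def crossTerm (σ : ℝ) (A D : Matrix (Fin d) (Fin d) ℝ) (T : ℕ) (η : ℕ → State d) : ℝ :=
  ∑ t ∈ Finset.range T,
    inner ℝ (Matrix.toEuclideanCLM (n := Fin d) (𝕜 := ℝ) D (state A η (t + 1))) (η (t + 1)) / σ ^ 2

/-- The quadratic variation `∑ ‖D X_t‖² / σ²` of `crossTerm`. -/
def quadTerm (σ : ℝ) (A D : Matrix (Fin d) (Fin d) ℝ) (T : ℕ) (η : ℕ → State d) : ℝ :=
  ∑ t ∈ Finset.range T,
    ‖Matrix.toEuclideanCLM (n := Fin d) (𝕜 := ℝ) D (state A η (t + 1))‖ ^ 2 / σ ^ 2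

variable (σ : ℝ) (A D : Matrix (Fin d) (Fin d) ℝ)

@[fun_prop]
lemma measurable_crossTerm (T : ℕ) : Measurable (crossTerm σ A D T) := by
  unfold crossTerm
  fun_prop

@[fun_prop]
lemma measurable_quadTerm (T : ℕ) : Measurable (quadTerm σ A D T) := by
  unfold quadTerm
  fun_prop

lemma crossTerm_succ (T : ℕ) (η : ℕ → State d) :
    crossTerm σ A D (T + 1) η = crossTerm σ A D T η +
      inner ℝ (Matrix.toEuclideanCLM (n := Fin d) (𝕜 := ℝ) D (trajectory A T η (Fin.last T)))
        (η (T + 1)) / σ ^ 2 := by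
  rw [crossTerm, Finset.sum_range_succ]
  simp [crossTerm, trajectory]

lemma quadTerm_succ (T : ℕ) (η : ℕ → State d) :
    quadTerm σ A D (T + 1) η = quadTerm σ A D T η +
      ‖Matrix.toEuclideanCLM (n := Fin d) (𝕜 := ℝ) D (trajectory A T η (Fin.last T))‖ ^ 2
        / σ ^ 2 := by
  rw [quadTerm, Finset.sum_range_succ]
  simp [quadTerm, trajectory]

lemma crossTerm_congr {T : ℕ} {η η' : ℕ → State d} (h : ∀ s < T + 1, η s = η' s) :
    crossTerm σ A D T η = crossTerm σ A D T η' :=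
  Finset.sum_congr rfl fun t ht => by
    have := Finset.mem_range.1 ht
    rw [state_congr A fun s hs => h s (by omega), h (t + 1) (by omega)]

lemma quadTerm_congr {T : ℕ} {η η' : ℕ → State d} (h : ∀ s < T + 1, η s = η' s) :
    quadTerm σ A D T η = quadTerm σ A D T η' :=
  Finset.sum_congr rfl fun t ht => by
    have := Finset.mem_range.1 ht
    rw [state_congr A fun s hs => h s (by omega)]

variable {σ}

lemma measurable_comp_snoc {T : ℕ} {f : (Fin (T + 2) → State d) → ℝ≥0∞} (hf : Measurable f)
    (M : State d →L[ℝ] State d) :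
    Measurable fun p : (Fin (T + 1) → State d) × State d =>
      f (Fin.snoc (α := fun _ => State d) p.1 (M (p.1 (Fin.last T)) + p.2)) := by
  have hlast : Measurable fun p : (Fin (T + 1) → State d) × State d => p.1 (Fin.last T) :=
    (measurable_pi_apply _).comp measurable_fst
  exact hf.comp ((measurable_snoc T).comp (measurable_fst.prodMk
    ((M.measurable.comp hlast).add measurable_snd)))

lemma lintegral_noise_snoc_sub (hσ : 0 < σ) {T : ℕ} {f : (Fin (T + 2) → State d) → ℝ≥0∞}
    (hf : Measurable f) (L K : State d →L[ℝ] State d) (x : Fin (T + 1) → State d) :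
    ∫⁻ y, f (Fin.snoc (α := fun _ => State d) x ((L - K) (x (Fin.last T)) + y)) ∂noise d σ =
      ∫⁻ y, f (Fin.snoc (α := fun _ => State d) x (L (x (Fin.last T)) + y)) *
        ENNReal.ofReal (Real.exp (-(inner ℝ (K (x (Fin.last T))) y / σ ^ 2 +
          ‖K (x (Fin.last T))‖ ^ 2 / σ ^ 2 / 2))) ∂noise d σ := by
  have hfx : Measurable fun y : State d =>
      f (Fin.snoc (α := fun _ => State d) x (L (x (Fin.last T)) + y)) :=
    (measurable_comp_snoc hf L).comp (measurable_prodMk_left (x := x))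
  have h := lintegral_noise_add hσ (-(K (x (Fin.last T)))) hfx
  have h1 : ∀ y, (L - K) (x (Fin.last T)) + y = L (x (Fin.last T)) + (-K (x (Fin.last T)) + y) := by
    intro y
    simp only [_root_.sub_apply]
    abel
  have h2 : ∀ y, (inner ℝ (-K (x (Fin.last T))) y - ‖-K (x (Fin.last T))‖ ^ 2 / 2) / σ ^ 2 =
      -(inner ℝ (K (x (Fin.last T))) y / σ ^ 2 + ‖K (x (Fin.last T))‖ ^ 2 / σ ^ 2 / 2) := by
    intro y
    rw [inner_neg_left, norm_neg]
    ring
  simp_rw [h1, ← h2]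
  exact h

/-- Change of measure between the trajectories of the systems with matrices `A - D` and `A`. -/
lemma lintegral_trajectory_sub (hσ : 0 < σ) (T : ℕ) {f : (Fin (T + 1) → State d) → ℝ≥0∞}
    (hf : Measurable f) :
    ∫⁻ η, f (trajectory (A - D) T η) ∂noiseLaw d σ =
      ∫⁻ η, f (trajectory A T η) * ENNReal.ofReal
        (Real.exp (-(crossTerm σ A D T η + quadTerm σ A D T η / 2))) ∂noiseLaw d σ := by
  induction T with
  | zero =>
    -- `X_1 = η_0` does not involve the matrix, so `T + 1` observations contribute only `T`
    -- likelihood factors.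
    refine lintegral_congr fun η => ?_
    have : trajectory (A - D) 0 η = trajectory A 0 η := by
      ext1 i
      fin_cases i
      simp [trajectory, state]
    simp [this, crossTerm, quadTerm]
  | succ T ih =>
    obtain ⟨L, hL⟩ : ∃ L, L = Matrix.toEuclideanCLM (n := Fin d) (𝕜 := ℝ) A := ⟨_, rfl⟩
    obtain ⟨K, hK⟩ : ∃ K, K = Matrix.toEuclideanCLM (n := Fin d) (𝕜 := ℝ) D := ⟨_, rfl⟩
    have hLK : Matrix.toEuclideanCLM (n := Fin d) (𝕜 := ℝ) (A - D) = L - K := by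
      rw [map_sub, hL, hK]
    have hlast : Measurable fun p : (Fin (T + 1) → State d) × State d => p.1 (Fin.last T) :=
      (measurable_pi_apply _).comp measurable_fst
    have hstep := measurable_comp_snoc hf
    have hshift := lintegral_noise_snoc_sub hσ hf L K
    let w : (ℕ → State d) → ℝ≥0∞ := fun η => ENNReal.ofReal
        (Real.exp (-(crossTerm σ A D T η + quadTerm σ A D T η / 2)))
    have hw : Measurable w := by fun_prop
    let F : (Fin (T + 1) → State d) → State d → ℝ≥0∞ := fun x y =>
      f (Fin.snoc (α := fun _ => State d) x (L (x (Fin.last T)) + y)) *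
          ENNReal.ofReal (Real.exp (-(inner ℝ (K (x (Fin.last T))) y / σ ^ 2 +
            ‖K (x (Fin.last T))‖ ^ 2 / σ ^ 2 / 2)))
    have hF : Measurable (Function.uncurry F) := by
      refine (hstep L).mul ?_
      have := K.measurable.comp hlast
      have h2 : Measurable fun p : (Fin (T + 1) → State d) × State d =>
          inner ℝ (K (p.1 (Fin.last T))) p.2 := this.inner measurable_snd
      have h3 : Measurable fun p : (Fin (T + 1) → State d) × State d =>
          ‖K (p.1 (Fin.last T))‖ := this.norm
      fun_prop
    have hFint : Measurable fun x => ∫⁻ y, F x y ∂noise d σ := Measurable.lintegral_prod_right hF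
    -- Integrate out the last noise and translate it by Cameron–Martin; what remains depends on the
    -- shorter trajectory, to which `ih` applies. Then restore the last noise.
    calc ∫⁻ η, f (trajectory (A - D) (T + 1) η) ∂noiseLaw d σ
        = ∫⁻ η, f (Fin.snoc (α := fun _ => State d) (trajectory (A - D) T η)
            ((L - K) (trajectory (A - D) T η (Fin.last T)) + η (T + 1))) ∂noiseLaw d σ := by
          simp_rw [trajectory_succ, hLK]
      _ = ∫⁻ η, ∫⁻ y, f (Fin.snoc (α := fun _ => State d) (trajectory (A - D) T η)
            ((L - K) (trajectory (A - D) T η (Fin.last T)) + y)) ∂noise d σ ∂noiseLaw d σ :=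
          lintegral_noiseLaw_past (T + 1) (g := trajectory (A - D) T)
            (F := fun x y => f (Fin.snoc (α := fun _ => State d) x
              ((L - K) (x (Fin.last T)) + y)))
            (measurable_trajectory _ _) (fun _ _ h => trajectory_congr _ h) (hstep (L - K))
      _ = ∫⁻ η, ∫⁻ y, F (trajectory (A - D) T η) y ∂noise d σ ∂noiseLaw d σ :=
          lintegral_congr fun η => hshift _
      _ = ∫⁻ η, (∫⁻ y, F (trajectory A T η) y ∂noise d σ) * w η ∂noiseLaw d σ :=
          ih hFint
      _ = ∫⁻ η, ∫⁻ y, F (trajectory A T η) y * w η ∂noise d σ ∂noiseLaw d σ := by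
          refine lintegral_congr fun η => (lintegral_mul_const _ ?_).symm
          exact hF.of_uncurry_left
      _ = ∫⁻ η, F (trajectory A T η) (η (T + 1)) * w η ∂noiseLaw d σ :=
          (lintegral_noiseLaw_past (T + 1) (g := fun η => (trajectory A T η, w η))
            (F := fun p y => F p.1 y * p.2) ((measurable_trajectory _ _).prodMk hw)
            (fun _ _ h => by
              simp only [w, trajectory_congr A h, crossTerm_congr σ A D h, quadTerm_congr σ A D h])
            ((hF.comp ((measurable_fst.comp measurable_fst).prodMk measurable_snd)).mul
              (measurable_snd.comp measurable_fst))).symm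
      _ = _ := by
          refine lintegral_congr fun η => ?_
          rw [trajectory_succ, crossTerm_succ, quadTerm_succ, ← hL, ← hK, mul_assoc,
            ← ENNReal.ofReal_mul (Real.exp_pos _).le, ← Real.exp_add]
          congr 3
          ring

end Likelihood

/-! ### Second moments of the state and mean of the quadratic variation. -/

section Moments

variable {d : ℕ} {σ : ℝ}

lemma scalarGramian_nonneg (t : ℕ) (ρ : ℝ) : 0 ≤ scalarGramian t ρ :=
  Finset.sum_nonneg fun _ _ => by positivity

lemma scalarGramian_succ (t : ℕ) (ρ : ℝ) :
    scalarGramian (t + 1) ρ = ρ ^ 2 * scalarGramian t ρ + 1 := by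
  rw [scalarGramian, Finset.sum_range_succ', scalarGramian, Finset.mul_sum]
  congr 1
  refine Finset.sum_congr rfl fun s _ => ?_
  rw [← sq_abs]
  ring

lemma scalarGramian_mono {s t : ℕ} (h : s ≤ t) (ρ : ℝ) :
    scalarGramian s ρ ≤ scalarGramian t ρ :=
  Finset.sum_le_sum_of_subset_of_nonneg (by simpa using h) fun _ _ _ => by positivity

/-- If `Aᵀ` scales norms by `|ρ|`, the state at time `t` has covariance `σ² γ_t(ρ) I`. -/
lemma lintegral_inner_state_sq {A : Matrix (Fin d) (Fin d) ℝ} {ρ : ℝ}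
    (hA : ∀ w, ‖(Matrix.toEuclideanCLM (n := Fin d) (𝕜 := ℝ) A).adjoint w‖ ^ 2 = ρ ^ 2 * ‖w‖ ^ 2)
    (t : ℕ) (w : State d) :
    ∫⁻ η, ENNReal.ofReal (inner ℝ w (state A η t) ^ 2) ∂noiseLaw d σ =
      ENNReal.ofReal (σ ^ 2 * scalarGramian t ρ * ‖w‖ ^ 2) := by
  induction t generalizing w with
  | zero => simp [state, scalarGramian]
  | succ t ih =>
    let L := Matrix.toEuclideanCLM (n := Fin d) (𝕜 := ℝ) A
    calc ∫⁻ η, ENNReal.ofReal (inner ℝ w (state A η (t + 1)) ^ 2) ∂noiseLaw d σ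
        = ∫⁻ η, ENNReal.ofReal ((inner ℝ (L.adjoint w) (state A η t) + inner ℝ w (η t)) ^ 2)
            ∂noiseLaw d σ := by
          simp_rw [state_succ, inner_add_right, ContinuousLinearMap.adjoint_inner_left]
          rfl
      _ = ∫⁻ η, ∫⁻ y, ENNReal.ofReal ((inner ℝ (L.adjoint w) (state A η t) + inner ℝ w y) ^ 2)
            ∂noise d σ ∂noiseLaw d σ :=
          lintegral_noiseLaw_past t (g := fun η => state A η t)
            (F := fun x y => ENNReal.ofReal ((inner ℝ (L.adjoint w) x + inner ℝ w y) ^ 2))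
            (by fun_prop) (fun _ _ h => state_congr A h) (by unfold Function.uncurry; fun_prop)
      _ = ∫⁻ η, (ENNReal.ofReal (inner ℝ (L.adjoint w) (state A η t) ^ 2) +
            ENNReal.ofReal (σ ^ 2 * ‖w‖ ^ 2)) ∂noiseLaw d σ := by
          refine lintegral_congr fun η => ?_
          rw [lintegral_noise_inner_add_sq, ENNReal.ofReal_add (sq_nonneg _) (by positivity)]
      _ = _ := by
          have := scalarGramian_nonneg t ρ
          rw [lintegral_add_right _ measurable_const, ih, lintegral_const, measure_univ, mul_one,
            ← ENNReal.ofReal_add (by positivity) (by positivity), hA, scalarGramian_succ]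
          congr 1
          ring

/-- Isotropy gives each `⟪w, X_t⟫²` the mean `σ² γ_t ‖w‖²`. Controlling `D` by two linear forms
therefore avoids a dimension factor, and `σ²` cancels. -/
lemma lintegral_quadTerm_le (hσ : 0 < σ) {A D : Matrix (Fin d) (Fin d) ℝ} {ρ : ℝ}
    (hA : ∀ w, ‖(Matrix.toEuclideanCLM (n := Fin d) (𝕜 := ℝ) A).adjoint w‖ ^ 2 = ρ ^ 2 * ‖w‖ ^ 2)
    (w₁ w₂ : State d)
    (hD : ∀ x, ‖Matrix.toEuclideanCLM (n := Fin d) (𝕜 := ℝ) D x‖ ^ 2 ≤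
      inner ℝ w₁ x ^ 2 + inner ℝ w₂ x ^ 2) (T : ℕ) :
    ∫⁻ η, ENNReal.ofReal (quadTerm σ A D T η) ∂noiseLaw d σ ≤
      ENNReal.ofReal (T * scalarGramian T ρ * (‖w₁‖ ^ 2 + ‖w₂‖ ^ 2)) := by
  have hterm : ∀ t ∈ Finset.range T,
      ∫⁻ η, ENNReal.ofReal (‖Matrix.toEuclideanCLM (n := Fin d) (𝕜 := ℝ) D
        (state A η (t + 1))‖ ^ 2 / σ ^ 2) ∂noiseLaw d σ ≤
      ENNReal.ofReal (scalarGramian T ρ * (‖w₁‖ ^ 2 + ‖w₂‖ ^ 2)) := by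
    intro t ht
    have hγ := scalarGramian_nonneg (t + 1) ρ
    calc _ ≤ ∫⁻ η, ENNReal.ofReal (1 / σ ^ 2) * (ENNReal.ofReal (inner ℝ w₁ (state A η (t + 1)) ^ 2)
          + ENNReal.ofReal (inner ℝ w₂ (state A η (t + 1)) ^ 2)) ∂noiseLaw d σ := by
          refine lintegral_mono fun η => ?_
          rw [← ENNReal.ofReal_add (sq_nonneg _) (sq_nonneg _),
            ← ENNReal.ofReal_mul (by positivity), div_eq_inv_mul, one_div]
          refine ENNReal.ofReal_le_ofReal ?_
          gcongr
          exact hD _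
      _ = ENNReal.ofReal (scalarGramian (t + 1) ρ * (‖w₁‖ ^ 2 + ‖w₂‖ ^ 2)) := by
          rw [lintegral_const_mul _ (by fun_prop), lintegral_add_left (by fun_prop),
            lintegral_inner_state_sq hA, lintegral_inner_state_sq hA,
            ← ENNReal.ofReal_add (by positivity) (by positivity),
            ← ENNReal.ofReal_mul (by positivity)]
          congr 1
          field_simp
      _ ≤ _ := by
          refine ENNReal.ofReal_le_ofReal ?_
          gcongr
          exact scalarGramian_mono (by simpa using ht) ρ
  unfold quadTerm
  calc _ = ∑ t ∈ Finset.range T, ∫⁻ η, ENNReal.ofReal (‖Matrix.toEuclideanCLM (n := Fin d) (𝕜 := ℝ)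
        D (state A η (t + 1))‖ ^ 2 / σ ^ 2) ∂noiseLaw d σ := by
        rw [← lintegral_finsetSum _ (fun t _ => by fun_prop)]
        exact lintegral_congr fun η => ENNReal.ofReal_sum_of_nonneg fun t _ => by positivity
    _ ≤ ∑ t ∈ Finset.range T, ENNReal.ofReal (scalarGramian T ρ * (‖w₁‖ ^ 2 + ‖w₂‖ ^ 2)) :=
        Finset.sum_le_sum hterm
    _ = _ := by
        rw [Finset.sum_const, Finset.card_range, nsmul_eq_mul, mul_assoc,
          ENNReal.ofReal_mul (Nat.cast_nonneg T), ENNReal.ofReal_natCast]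

end Moments


/-! ### Transfer of likely events by truncating the likelihood ratio. -/

section LowerBound

variable {d : ℕ} {σ : ℝ} {A D : Matrix (Fin d) (Fin d) ℝ}

lemma crossTerm_smul (c : ℝ) (T : ℕ) (η : ℕ → State d) :
    crossTerm σ A (c • D) T η = c * crossTerm σ A D T η := by
  rw [crossTerm, crossTerm, Finset.mul_sum]
  refine Finset.sum_congr rfl fun t _ => ?_
  rw [map_smul, _root_.smul_apply, real_inner_smul_left, mul_div_assoc]

lemma quadTerm_smul (c : ℝ) (T : ℕ) (η : ℕ → State d) :
    quadTerm σ A (c • D) T η = c ^ 2 * quadTerm σ A D T η := by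
  rw [quadTerm, quadTerm, Finset.mul_sum]
  refine Finset.sum_congr rfl fun t _ => ?_
  rw [map_smul, _root_.smul_apply, norm_smul, mul_pow, mul_div_assoc, Real.norm_eq_abs, sq_abs]

/-- The exponential martingale of `crossTerm` has mean one. -/
lemma lintegral_exp_crossTerm (hσ : 0 < σ) (c : ℝ) (T : ℕ) :
    ∫⁻ η, ENNReal.ofReal (Real.exp (c * crossTerm σ A D T η - c ^ 2 * quadTerm σ A D T η / 2))
      ∂noiseLaw d σ = 1 := by
  -- With `f = 1` and difference `-c D`, the change of measure says that the likelihood ratio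
  -- integrates to one.
  have h := lintegral_trajectory_sub A ((-c) • D) hσ T
    (f := fun _ => 1) measurable_const
  simp only [lintegral_const, measure_univ, one_mul, mul_one, crossTerm_smul, quadTerm_smul] at h
  rw [h]
  refine lintegral_congr fun η => ?_
  congr 2
  ring

/-- Markov's inequality for the exponential martingale at `c = 30`: on the event its exponent is at
least `30 · (1/10) = 3`, and `exp 3 ≥ 8`. -/
lemma noiseLaw_crossTerm_ge_le (hσ : 0 < σ) (T : ℕ) :
    noiseLaw d σ {η | 15 * quadTerm σ A D T η + 1 / 10 ≤ crossTerm σ A D T η} ≤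
      ENNReal.ofReal (1 / 8) := by
  have hmarkov := mul_meas_ge_le_lintegral (μ := noiseLaw d σ)
    (f := fun η => ENNReal.ofReal
      (Real.exp (30 * crossTerm σ A D T η - 30 ^ 2 * quadTerm σ A D T η / 2)))
    (by fun_prop) (ENNReal.ofReal 8)
  rw [lintegral_exp_crossTerm hσ] at hmarkov
  have h8 : (8 : ℝ) ≤ Real.exp 3 := by
    have h1 : (2 : ℝ) ≤ Real.exp 1 := by linarith [Real.add_one_le_exp (1 : ℝ)]
    calc (8 : ℝ) = 2 ^ 3 := by norm_num
      _ ≤ Real.exp 1 ^ 3 := by gcongr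
      _ = Real.exp 3 := by rw [← Real.exp_nat_mul]; norm_num
  have hsub : {η | 15 * quadTerm σ A D T η + 1 / 10 ≤ crossTerm σ A D T η} ⊆
      {η | ENNReal.ofReal 8 ≤ ENNReal.ofReal
        (Real.exp (30 * crossTerm σ A D T η - 30 ^ 2 * quadTerm σ A D T η / 2))} := by
    intro η hη
    simp only [Set.mem_ofPred_eq] at hη ⊢
    refine ENNReal.ofReal_le_ofReal (h8.trans (Real.exp_le_exp.2 ?_))
    linarith
  calc _ ≤ _ := measure_mono hsub
    _ ≤ 1 / ENNReal.ofReal 8 := by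
      rw [ENNReal.le_div_iff_mul_le (by simp) (by simp), mul_comm]
      exact hmarkov
    _ = _ := by rw [ENNReal.ofReal_div_of_pos (by norm_num), ENNReal.ofReal_one]

lemma noiseLaw_quadTerm_ge_le {T : ℕ} {R : ℝ} (hR : 0 < R)
    (hquad : ∫⁻ η, ENNReal.ofReal (quadTerm σ A D T η) ∂noiseLaw d σ ≤ ENNReal.ofReal R) :
    noiseLaw d σ {η | 8 * R ≤ quadTerm σ A D T η} ≤ ENNReal.ofReal (1 / 8) := by
  have hmarkov := (mul_meas_ge_le_lintegral (μ := noiseLaw d σ)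
    (f := fun η => ENNReal.ofReal (quadTerm σ A D T η))
    (by fun_prop) (ENNReal.ofReal (8 * R))).trans hquad
  have hsub : {η | 8 * R ≤ quadTerm σ A D T η} ⊆
      {η | ENNReal.ofReal (8 * R) ≤ ENNReal.ofReal (quadTerm σ A D T η)} :=
    fun η hη => ENNReal.ofReal_le_ofReal hη
  calc _ ≤ _ := measure_mono hsub
    _ ≤ ENNReal.ofReal R / ENNReal.ofReal (8 * R) := by
      rw [ENNReal.le_div_iff_mul_le (by simp [hR]) (by simp), mul_comm]
      exact hmarkov
    _ = _ := by
      rw [← ENNReal.ofReal_div_of_pos (by positivity)]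
      congr 1
      field_simp

/-- An event that is likely for the system `A` is not too unlikely for the system `A - D`. -/
lemma le_trajectoryLaw_sub (hσ : 0 < σ) {T : ℕ} {R : ℝ} (hR : 0 < R)
    (hquad : ∫⁻ η, ENNReal.ofReal (quadTerm σ A D T η) ∂noiseLaw d σ ≤ ENNReal.ofReal R)
    {G : Set (Fin (T + 1) → State d)} (hG : MeasurableSet G)
    (hAG : ENNReal.ofReal (3 / 4) ≤ trajectoryLaw σ A T G) :
    ENNReal.ofReal (Real.exp (-(124 * R + 1 / 10)) / 2) ≤ trajectoryLaw σ (A - D) T G := by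
  set E₁ := {η | 15 * quadTerm σ A D T η + 1 / 10 ≤ crossTerm σ A D T η} with hE₁
  set E₂ := {η | 8 * R ≤ quadTerm σ A D T η} with hE₂
  set S := trajectory A T ⁻¹' G with hS
  have hSm : MeasurableSet S := measurable_trajectory A T hG
  have hE₁m : MeasurableSet E₁ := measurableSet_le (by fun_prop) (by fun_prop)
  have hE₂m : MeasurableSet E₂ := measurableSet_le (by fun_prop) (by fun_prop)
  have hhalf : ENNReal.ofReal (1 / 2) ≤ noiseLaw d σ (S \ (E₁ ∪ E₂)) := by
    rw [trajectoryLaw, Measure.map_apply (measurable_trajectory A T) hG] at hAG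
    calc ENNReal.ofReal (1 / 2) = ENNReal.ofReal (3 / 4) - ENNReal.ofReal (1 / 4) := by
          rw [← ENNReal.ofReal_sub _ (by norm_num)]
          norm_num
      _ ≤ noiseLaw d σ S - noiseLaw d σ (E₁ ∪ E₂) := by
          refine tsub_le_tsub hAG ((measure_union_le _ _).trans ?_)
          calc _ ≤ ENNReal.ofReal (1 / 8) + ENNReal.ofReal (1 / 8) :=
                add_le_add (noiseLaw_crossTerm_ge_le hσ T) (noiseLaw_quadTerm_ge_le hR hquad)
            _ = _ := by
                rw [← ENNReal.ofReal_add (by norm_num) (by norm_num)]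
                norm_num
      _ ≤ _ := le_measure_sdiff
  have hind : Measurable (G.indicator (1 : (Fin (T + 1) → State d) → ℝ≥0∞)) :=
    measurable_one.indicator hG
  have key : trajectoryLaw σ (A - D) T G = ∫⁻ η, G.indicator 1 (trajectory A T η) *
      ENNReal.ofReal (Real.exp (-(crossTerm σ A D T η + quadTerm σ A D T η / 2)))
        ∂noiseLaw d σ := by
    rw [← lintegral_trajectory_sub A D hσ T hind,
      ← lintegral_map hind (measurable_trajectory (A - D) T), lintegral_indicator_one hG]
    rfl
  rw [key]
  calc ENNReal.ofReal (Real.exp (-(124 * R + 1 / 10)) / 2)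
      = ENNReal.ofReal (Real.exp (-(124 * R + 1 / 10))) * ENNReal.ofReal (1 / 2) := by
        rw [← ENNReal.ofReal_mul (Real.exp_pos _).le]
        congr 1
        ring
    _ ≤ ENNReal.ofReal (Real.exp (-(124 * R + 1 / 10))) * noiseLaw d σ (S \ (E₁ ∪ E₂)) := by
        gcongr
    _ = ∫⁻ η, (S \ (E₁ ∪ E₂)).indicator
          (fun _ => ENNReal.ofReal (Real.exp (-(124 * R + 1 / 10)))) η ∂noiseLaw d σ :=
        (lintegral_indicator_const (hSm.diff (hE₁m.union hE₂m)) _).symm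
    _ ≤ _ := by
        refine lintegral_mono fun η => ?_
        by_cases hη : η ∈ S \ (E₁ ∪ E₂)
        · have hηG : trajectory A T η ∈ G := hη.1
          have h1 : η ∉ E₁ := fun h => hη.2 (Or.inl h)
          have h2 : η ∉ E₂ := fun h => hη.2 (Or.inr h)
          simp only [hE₁, hE₂, Set.mem_ofPred_eq, not_le] at h1 h2
          rw [Set.indicator_of_mem hη, Set.indicator_of_mem hηG, Pi.one_apply, one_mul]
          -- Here `M + Q/2 < (15 + 1/2) Q + 1/10` and `Q < 8 R`, whence `124 R + 1/10`.
          exact ENNReal.ofReal_le_ofReal (Real.exp_le_exp.2 (by linarith))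
        · rw [Set.indicator_of_notMem hη]
          exact zero_le

end LowerBound


/-! ### Operator norm and scaled orthogonal matrices. -/

section OpNorm

variable {d : ℕ}

lemma opNorm_sub_le (A B C : Matrix (Fin d) (Fin d) ℝ) :
    opNorm (A - B) ≤ opNorm (C - A) + opNorm (C - B) := by
  simp only [opNorm, map_sub]
  rw [← dist_eq_norm, ← dist_eq_norm, ← dist_eq_norm]
  exact dist_triangle_left _ _ _

lemma measurable_opNorm_sub {X : Type*} [MeasurableSpace X] {f : X → Matrix (Fin d) (Fin d) ℝ}
    (hf : ∀ i j, Measurable fun x => f x i j) (B : Matrix (Fin d) (Fin d) ℝ) :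
    Measurable fun x => opNorm (f x - B) := by
  let Φ : (Fin d → Fin d → ℝ) →ₗ[ℝ] (State d →L[ℝ] State d) :=
    (Matrix.toEuclideanCLM (n := Fin d) (𝕜 := ℝ)).toAlgEquiv.toLinearMap ∘ₗ
      (Matrix.ofLinearEquiv ℝ).toLinearMap
  have hΦ : Continuous fun y : Fin d → Fin d → ℝ => ‖Φ y - Φ (Matrix.of.symm B)‖ :=
    (Φ.continuous_of_finiteDimensional.sub continuous_const).norm
  have hf' : Measurable fun x => Matrix.of.symm (f x) :=
    measurable_pi_lambda _ fun i => measurable_pi_lambda _ fun j => hf i j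
  convert! hΦ.measurable.comp hf' using 2 with x
  rw [opNorm, map_sub]
  rfl

lemma norm_adjoint_smul_orthogonal (ρ : ℝ) (O : Matrix.orthogonalGroup (Fin d) ℝ) (w : State d) :
    ‖(Matrix.toEuclideanCLM (n := Fin d) (𝕜 := ℝ)
      (ρ • (O : Matrix (Fin d) (Fin d) ℝ))).adjoint w‖ ^ 2 = ρ ^ 2 * ‖w‖ ^ 2 := by
  rw [← real_inner_self_eq_norm_sq, ContinuousLinearMap.adjoint_inner_left,
    ← ContinuousLinearMap.star_eq_adjoint, ← map_star, ← mul_apply_eq_comp, ← map_mul]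
  have hO : ρ • (O : Matrix (Fin d) (Fin d) ℝ) * star (ρ • (O : Matrix (Fin d) (Fin d) ℝ)) =
      ρ ^ 2 • 1 := by
    rw [star_smul, smul_mul_smul_comm, Matrix.mem_unitaryGroup_iff.1 O.2, sq]
    rfl
  rw [hO, map_smul, map_one, _root_.smul_apply, one_apply_eq_self, real_inner_smul_right,
    real_inner_self_eq_norm_sq]

end OpNorm

/-! ### Distances between scaled Householder reflections. -/

section Householder

variable {d : ℕ}

/-- The Householder reflection in the hyperplane orthogonal to the unit vector `u`. -/
def householder (u : State d) : Matrix (Fin d) (Fin d) ℝ :=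
  1 - (2 : ℝ) • Matrix.vecMulVec u u

lemma toEuclideanCLM_householder (u x : State d) :
    Matrix.toEuclideanCLM (n := Fin d) (𝕜 := ℝ) (householder u) x =
      x - (2 * inner ℝ u x) • u := by
  ext i
  simp only [householder, Matrix.vecMulVec_mulVec, PiLp.inner_apply, dotProduct, map_sub, map_one,
    map_smul, Matrix.ofLp_toEuclideanCLM, _root_.sub_apply, _root_.smul_apply, PiLp.sub_apply,
    PiLp.smul_apply]
  simp [mul_comm, mul_left_comm]

lemma householder_mem_orthogonalGroup {u : State d} (hu : ‖u‖ = 1) :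
    householder u ∈ Matrix.orthogonalGroup (Fin d) ℝ := by
  have huu : (u : Fin d → ℝ) ⬝ᵥ u = 1 := by
    have := EuclideanSpace.real_norm_sq_eq u
    rw [hu] at this
    simp only [dotProduct, ← sq]
    linarith
  rw [Matrix.mem_orthogonalGroup_iff, householder, Matrix.transpose_sub, Matrix.transpose_smul,
    Matrix.transpose_vecMulVec, Matrix.transpose_one, sub_mul, mul_sub, mul_sub, smul_mul_smul_comm,
    Matrix.vecMulVec_mul_vecMulVec, huu]
  simp only [mul_one, one_mul, one_smul]
  module

/-- The Householder reflection as an element of the orthogonal group. -/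
def reflection (u : State d) (hu : ‖u‖ = 1) : Matrix.orthogonalGroup (Fin d) ℝ :=
  ⟨householder u, householder_mem_orthogonalGroup hu⟩

variable {e u u' : State d} {ρ : ℝ}

lemma toEuclideanCLM_smul_householder_sub (ρ : ℝ) (u u' x : State d) :
    Matrix.toEuclideanCLM (n := Fin d) (𝕜 := ℝ) (ρ • householder u - ρ • householder u') x =
      (2 * ρ) • (inner ℝ u' x • u' - inner ℝ u x • u) := by
  rw [← smul_sub, map_smul, map_sub, _root_.smul_apply, _root_.sub_apply,
    toEuclideanCLM_householder, toEuclideanCLM_householder]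
  module

/-- Split `⟪e,x⟫e - ⟪u,x⟫u` as `⟪e-u,x⟫e + ⟪u,x⟫(e-u)`. The resulting factor `8 ρ²` is rounded up to
`(3ρ)²`, so that it fits inside the linear forms required by `lintegral_quadTerm_le`. -/
lemma norm_smul_householder_sub_sq_le (he : ‖e‖ = 1) (x : State d) :
    ‖Matrix.toEuclideanCLM (n := Fin d) (𝕜 := ℝ) (ρ • householder u - ρ • householder e) x‖ ^ 2 ≤
      inner ℝ ((3 * ρ) • (e - u)) x ^ 2 + inner ℝ ((3 * ρ * ‖e - u‖) • u) x ^ 2 := by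
  have h1 : inner ℝ e x • e - inner ℝ u x • u =
      inner ℝ (e - u) x • e + inner ℝ u x • (e - u) := by
    rw [inner_sub_left]
    module
  have h2 : ‖inner ℝ e x • e - inner ℝ u x • u‖ ≤
      |inner ℝ (e - u) x| + |inner ℝ u x| * ‖e - u‖ := by
    rw [h1]
    refine (norm_add_le _ _).trans (le_of_eq ?_)
    rw [norm_smul, norm_smul, he, mul_one, Real.norm_eq_abs, Real.norm_eq_abs]
  rw [toEuclideanCLM_smul_householder_sub, norm_smul, mul_pow, Real.norm_eq_abs, sq_abs,
    real_inner_smul_left, real_inner_smul_left]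
  have h3 : ‖inner ℝ e x • e - inner ℝ u x • u‖ ^ 2 ≤
      2 * (inner ℝ (e - u) x ^ 2 + (inner ℝ u x * ‖e - u‖) ^ 2) := by
    calc _ ≤ (|inner ℝ (e - u) x| + |inner ℝ u x| * ‖e - u‖) ^ 2 := by gcongr
      _ ≤ 2 * (|inner ℝ (e - u) x| ^ 2 + (|inner ℝ u x| * ‖e - u‖) ^ 2) := add_sq_le
      _ = _ := by rw [mul_pow, mul_pow, sq_abs, sq_abs]
  have h4 : 0 ≤ inner ℝ (e - u) x ^ 2 + (inner ℝ u x * ‖e - u‖) ^ 2 := by positivity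
  nlinarith [mul_le_mul_of_nonneg_left h3 (sq_nonneg ρ), mul_nonneg (sq_nonneg ρ) h4]

/-- Test on `e`: equal inner products with `e` make the image a multiple of `u' - u`. -/
lemma le_opNorm_householder_sub (he : ‖e‖ = 1) {c : ℝ} (hc : 0 ≤ c) (hu : inner ℝ u e = c)
    (hu' : inner ℝ u' e = c) :
    2 * |ρ| * c * ‖u - u'‖ ≤ opNorm (ρ • householder u - ρ • householder u') := by
  have h := (Matrix.toEuclideanCLM (n := Fin d) (𝕜 := ℝ)
    (ρ • householder u - ρ • householder u')).le_opNorm e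
  rw [he, mul_one, toEuclideanCLM_smul_householder_sub, hu, hu', ← smul_sub, norm_smul, norm_smul,
    Real.norm_eq_abs, Real.norm_eq_abs, abs_mul, abs_of_nonneg hc, abs_two, norm_sub_rev] at h
  rw [opNorm]
  linarith

lemma le_opNorm_householder_sub_base (he : ‖e‖ = 1) (hu : ‖u‖ = 1) {c s : ℝ} (hs : 0 ≤ s)
    (hcs : c ^ 2 + s ^ 2 = 1) (hue : inner ℝ u e = c) :
    2 * |ρ| * s ≤ opNorm (ρ • householder u - ρ • householder e) := by
  have h := (Matrix.toEuclideanCLM (n := Fin d) (𝕜 := ℝ)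
    (ρ • householder u - ρ • householder e)).le_opNorm e
  have h1 : ‖e - c • u‖ = s := by
    rw [← sq_eq_sq₀ (norm_nonneg _) hs, norm_sub_sq_real, real_inner_smul_right, real_inner_comm,
      hue, norm_smul, mul_pow, Real.norm_eq_abs, sq_abs, he, hu]
    linarith
  rw [he, mul_one, toEuclideanCLM_smul_householder_sub, hue, real_inner_self_eq_norm_sq, he,
    one_pow, one_smul, norm_smul, h1, Real.norm_eq_abs, abs_mul,
    abs_two] at h
  exact h

end Householder

/-! ### Unit vectors indexed by the sign cube. -/

section Hypercube

variable {n : ℕ}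

/-- The sign encoded by a Boolean. -/
def signOf (b : Bool) : ℝ := if b then 1 else -1

lemma signOf_sq (b : Bool) : signOf b ^ 2 = 1 := by
  cases b <;> simp [signOf]

/-- The correlation of two sign vectors. -/
def correlation (v v' : Fin n → Bool) : ℝ := ∑ i, signOf (v i) * signOf (v' i)

/-- Few sign vectors are strongly correlated with a given one. -/
lemma card_correlation_gt_le (v' : Fin n → Bool) :
    ((Finset.univ.filter fun v : Fin n → Bool => (n : ℝ) / 2 < correlation v v').card : ℝ) ≤
      2 ^ n * Real.exp (-(n / 8)) := by
  -- Chernoff bound at parameter `1/2`: `cosh (1/2) ≤ exp (1/8)` gives the moment bound, and the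
  -- threshold `n/2` costs `exp (n/4)`.
  have hsum : ∑ v : Fin n → Bool, Real.exp (correlation v v' / 2) ≤
      2 ^ n * Real.exp (n / 8) := by
    calc ∑ v : Fin n → Bool, Real.exp (correlation v v' / 2)
        = ∑ v : Fin n → Bool, ∏ i, Real.exp (signOf (v i) * signOf (v' i) / 2) := by
          simp_rw [correlation, Finset.sum_div, Real.exp_sum]
      _ = ∏ i, ∑ b : Bool, Real.exp (signOf b * signOf (v' i) / 2) := by
          rw [Finset.prod_univ_sum, Fintype.piFinset_univ]
      _ = ∏ i : Fin n, (2 * Real.cosh (1 / 2)) := by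
          refine Finset.prod_congr rfl fun i _ => ?_
          rw [Real.cosh_eq]
          cases v' i <;> simp [signOf] <;> ring_nf
      _ ≤ ∏ i : Fin n, (2 * Real.exp ((1 / 2) ^ 2 / 2)) := by
          refine Finset.prod_le_prod (fun i _ => by positivity) fun i _ => ?_
          gcongr
          exact Real.cosh_le_exp_half_sq _
      _ = _ := by
          rw [Finset.prod_const, Finset.card_univ, Fintype.card_fin, mul_pow, ← Real.exp_nat_mul]
          congr 2
          ring
  have hcard : ((Finset.univ.filter fun v : Fin n → Bool =>
      (n : ℝ) / 2 < correlation v v').card : ℝ) * Real.exp (n / 4) ≤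
      ∑ v : Fin n → Bool, Real.exp (correlation v v' / 2) := by
    rw [← nsmul_eq_mul, ← Finset.sum_const]
    calc _ ≤ ∑ v ∈ Finset.univ.filter fun v : Fin n → Bool => (n : ℝ) / 2 < correlation v v',
          Real.exp (correlation v v' / 2) := by
          refine Finset.sum_le_sum fun v hv => Real.exp_le_exp.2 ?_
          have := (Finset.mem_filter.1 hv).2
          linarith
      _ ≤ _ := Finset.sum_le_sum_of_subset_of_nonneg (Finset.filter_subset _ _)
          fun _ _ _ => (Real.exp_pos _).le
  have h := hcard.trans hsum
  rw [← le_div_iff₀ (Real.exp_pos _), mul_div_assoc, ← Real.exp_sub] at h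
  convert! h using 3
  ring

/-- The base unit vector of the packing. -/
def baseVec (n : ℕ) : State (n + 1) := EuclideanSpace.single 0 1

/-- The unit vectors `(c, s v / √n)` for sign vectors `v`. -/
def signVec (c s : ℝ) (v : Fin n → Bool) : State (n + 1) :=
  WithLp.toLp 2 (Fin.cons c fun i => s * signOf (v i) / √n)

lemma norm_baseVec : ‖baseVec n‖ = 1 := by
  simp [baseVec]

lemma inner_signVec_baseVec (c s : ℝ) (v : Fin n → Bool) :
    inner ℝ (signVec c s v) (baseVec n) = c := by
  rw [PiLp.inner_apply, Fin.sum_univ_succ]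
  simp [baseVec, signVec]

lemma inner_signVec (c s : ℝ) (v v' : Fin n → Bool) :
    inner ℝ (signVec c s v) (signVec c s v') = c ^ 2 + s ^ 2 * correlation v v' / n := by
  rw [PiLp.inner_apply, Fin.sum_univ_succ]
  simp only [signVec, Fin.cons_zero, Fin.cons_succ, correlation]
  rw [Finset.mul_sum, Finset.sum_div]
  congr 1
  · simp [sq]
  · refine Finset.sum_congr rfl fun i _ => ?_
    have : √(n : ℝ) * √n = n := Real.mul_self_sqrt (Nat.cast_nonneg n)
    simp
    rw [div_mul_div_comm, this]
    ring

lemma correlation_self (v : Fin n → Bool) : correlation v v = n := by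
  simp [correlation, ← sq, signOf_sq]

variable {c s : ℝ}

lemma norm_signVec (hn : n ≠ 0) (hcs : c ^ 2 + s ^ 2 = 1) (v : Fin n → Bool) :
    ‖signVec c s v‖ = 1 := by
  rw [← sq_eq_sq₀ (norm_nonneg _) zero_le_one, ← real_inner_self_eq_norm_sq, inner_signVec,
    correlation_self, mul_div_cancel_right₀ _ (Nat.cast_ne_zero.2 hn), hcs, one_pow]

/-- The squared distance is `2 s² (1 - correlation / n)`. -/
lemma le_norm_signVec_sub (hn : n ≠ 0) (hcs : c ^ 2 + s ^ 2 = 1) (hs : 0 ≤ s)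
    {v v' : Fin n → Bool} (h : correlation v v' ≤ n / 2) :
    s ≤ ‖signVec c s v - signVec c s v'‖ := by
  have hn' : (0 : ℝ) < n := by exact_mod_cast Nat.pos_of_ne_zero hn
  rw [← sq_le_sq₀ hs (norm_nonneg _), norm_sub_sq_real, norm_signVec hn hcs, norm_signVec hn hcs,
    inner_signVec, mul_div_assoc]
  have h1 : correlation v v' / n ≤ 1 / 2 := by
    rw [div_le_iff₀ hn']
    linarith
  nlinarith [mul_le_mul_of_nonneg_left h1 (sq_nonneg s)]

lemma norm_baseVec_sub_signVec_sq (hn : n ≠ 0) (hcs : c ^ 2 + s ^ 2 = 1) (v : Fin n → Bool) :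
    ‖baseVec n - signVec c s v‖ ^ 2 = 2 - 2 * c := by
  rw [norm_sub_sq_real, norm_signVec hn hcs, norm_baseVec, real_inner_comm, inner_signVec_baseVec]
  ring

end Hypercube


/-! ### Success events of the estimator. -/

section Estimation

variable {d : ℕ} {σ : ℝ}

instance isProbabilityMeasure_trajectoryLaw (A : Matrix (Fin d) (Fin d) ℝ) (T : ℕ) :
    IsProbabilityMeasure (trajectoryLaw σ A T) :=
  Measure.isProbabilityMeasure_map (measurable_trajectory A T).aemeasurable

/-- The event that the estimate is within `ε` of `A`. -/
def goodEvent {T : ℕ} (Ahat : (Fin (T + 1) → State d) → Matrix (Fin d) (Fin d) ℝ) (ε : ℝ)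
    (A : Matrix (Fin d) (Fin d) ℝ) : Set (Fin (T + 1) → State d) :=
  {x | opNorm (Ahat x - A) < ε}

variable {T : ℕ} {Ahat : (Fin (T + 1) → State d) → Matrix (Fin d) (Fin d) ℝ} {ε δ : ℝ}

lemma measurableSet_goodEvent (hAhat : ∀ i j, Measurable fun x => Ahat x i j) (ε : ℝ)
    (A : Matrix (Fin d) (Fin d) ℝ) : MeasurableSet (goodEvent Ahat ε A) :=
  measurableSet_lt (measurable_opNorm_sub hAhat A) measurable_const

lemma le_trajectoryLaw_goodEvent (hAhat : ∀ i j, Measurable fun x => Ahat x i j)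
    (hδ : δ ≤ 1 / 4) {A : Matrix (Fin d) (Fin d) ℝ}
    (h : trajectoryLaw σ A T {x | ε ≤ opNorm (Ahat x - A)} < ENNReal.ofReal δ) :
    ENNReal.ofReal (3 / 4) ≤ trajectoryLaw σ A T (goodEvent Ahat ε A) := by
  have hcompl : {x | ε ≤ opNorm (Ahat x - A)} = (goodEvent Ahat ε A)ᶜ := by
    ext x
    simp [goodEvent]
  rw [hcompl] at h
  have hsum := prob_add_prob_compl (μ := trajectoryLaw σ A T) (measurableSet_goodEvent hAhat ε A)
  have hle : trajectoryLaw σ A T (goodEvent Ahat ε A)ᶜ ≤ ENNReal.ofReal (1 / 4) :=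
    h.le.trans (ENNReal.ofReal_le_ofReal hδ)
  have h1 : ENNReal.ofReal (3 / 4) + ENNReal.ofReal (1 / 4) ≤
      trajectoryLaw σ A T (goodEvent Ahat ε A) + ENNReal.ofReal (1 / 4) := by
    calc _ = 1 := by
          rw [← ENNReal.ofReal_add (by norm_num) (by norm_num)]
          norm_num
      _ = _ := hsum.symm
      _ ≤ _ := by gcongr
  exact (ENNReal.add_le_add_iff_right ENNReal.ofReal_ne_top).1 h1

lemma lt_of_mem_goodEvent {A B : Matrix (Fin d) (Fin d) ℝ} {x : Fin (T + 1) → State d}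
    (hA : x ∈ goodEvent Ahat ε A) (hB : x ∈ goodEvent Ahat ε B) : opNorm (A - B) < 2 * ε := by
  have h := opNorm_sub_le A B (Ahat x)
  simp only [goodEvent, Set.mem_ofPred_eq] at hA hB
  linarith

end Estimation

/-! ### Success events of the alternatives under the base law. -/

section Packing

variable {n T : ℕ} {ρ σ ε c s K : ℝ}
  {Ahat : (Fin (T + 1) → State (n + 1)) → Matrix (Fin (n + 1)) (Fin (n + 1)) ℝ}

lemma le_trajectoryLaw_base_goodEvent (hσ : 0 < σ) (hn : n ≠ 0) (hcs : c ^ 2 + s ^ 2 = 1)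
    (hc : 0 ≤ c) (hK : 0 < K) (hT : T * scalarGramian T ρ * (36 * ρ ^ 2 * s ^ 2) ≤ K)
    (hAhat : ∀ i j, Measurable fun x => Ahat x i j) (v : Fin n → Bool)
    (h : ENNReal.ofReal (3 / 4) ≤ trajectoryLaw σ (ρ • householder (signVec c s v)) T
      (goodEvent Ahat ε (ρ • householder (signVec c s v)))) :
    ENNReal.ofReal (Real.exp (-(124 * K + 1 / 10)) / 2) ≤
      trajectoryLaw σ (ρ • householder (baseVec n)) T
        (goodEvent Ahat ε (ρ • householder (signVec c s v))) := by
  set u := signVec c s v with hu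
  set A := ρ • householder u with hA
  set B := ρ • householder (baseVec n) with hB
  have hu1 : ‖u‖ = 1 := norm_signVec hn hcs v
  -- The alternative is the reference measure, since the success event is known to be likely there.
  have hAB : B = A - (A - B) := (sub_sub_cancel A B).symm
  rw [hAB]
  refine le_trajectoryLaw_sub hσ hK ?_ (measurableSet_goodEvent hAhat _ _) h
  refine (lintegral_quadTerm_le hσ (ρ := ρ)
    (norm_adjoint_smul_orthogonal ρ (reflection u hu1)) _ _
    (norm_smul_householder_sub_sq_le norm_baseVec) T).trans (ENNReal.ofReal_le_ofReal ?_)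
  refine le_trans ?_ hT
  have hγ := scalarGramian_nonneg T ρ
  refine mul_le_mul_of_nonneg_left ?_ (by positivity)
  rw [norm_smul, norm_smul, hu1, mul_one, mul_pow, Real.norm_eq_abs, Real.norm_eq_abs, sq_abs,
    sq_abs, mul_pow (3 * ρ) ‖baseVec n - u‖, norm_baseVec_sub_signVec_sq hn hcs]
  have hc1 : c ≤ 1 := by nlinarith [sq_nonneg s]
  -- For `0 ≤ c ≤ 1`, `1 - c ≤ 1 - c² = s²`.
  have h1 : 2 - 2 * c ≤ 2 * s ^ 2 := by nlinarith
  nlinarith [mul_le_mul_of_nonneg_left h1 (sq_nonneg ρ)]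

lemma correlation_gt_of_mem_goodEvent (hn : n ≠ 0) (hcs : c ^ 2 + s ^ 2 = 1) (hc : 1 / 2 ≤ c)
    (hs : 0 ≤ s) (hε : 2 * ε ≤ |ρ| * s) {v v' : Fin n → Bool} {x : Fin (T + 1) → State (n + 1)}
    (hv : x ∈ goodEvent Ahat ε (ρ • householder (signVec c s v)))
    (hv' : x ∈ goodEvent Ahat ε (ρ • householder (signVec c s v'))) :
    (n : ℝ) / 2 < correlation v v' := by
  by_contra! hcor
  have h1 := lt_of_mem_goodEvent hv hv'
  have h2 := le_opNorm_householder_sub (ρ := ρ) (e := baseVec n) norm_baseVec (by linarith)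
    (inner_signVec_baseVec c s v) (inner_signVec_baseVec c s v')
  have h3 := le_norm_signVec_sub hn hcs hs hcor
  have h4 : |ρ| * s ≤ 2 * |ρ| * c * ‖signVec c s v - signVec c s v'‖ := by
    calc |ρ| * s = 2 * |ρ| * (1 / 2) * s := by ring
      _ ≤ _ := by gcongr
  linarith

/-- No base law can make all the good events likely at once. -/
lemma exists_trajectoryLaw_goodEvent_le (hn : n ≠ 0) (hcs : c ^ 2 + s ^ 2 = 1) (hc : 1 / 2 ≤ c)
    (hs : 0 ≤ s) (hε : 2 * ε ≤ |ρ| * s) (hAhat : ∀ i j, Measurable fun x => Ahat x i j)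
    (μ : Measure (Fin (T + 1) → State (n + 1))) [IsProbabilityMeasure μ] {m : ℝ}
    (h : ∀ v : Fin n → Bool, ENNReal.ofReal m ≤
      μ (goodEvent Ahat ε (ρ • householder (signVec c s v)))) :
    m ≤ Real.exp (-(n / 8)) := by
  classical
  let G : (Fin n → Bool) → Set (Fin (T + 1) → State (n + 1)) := fun v =>
    goodEvent Ahat ε (ρ • householder (signVec c s v))
  -- No separated subset of the cube is extracted: any one success `v'` at `x` confines all others
  -- to those strongly correlated with `v'`.
  have hcount : ∀ x, ∑ v, (G v).indicator (fun _ => (1 : ℝ≥0∞)) x ≤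
      ENNReal.ofReal (2 ^ n * Real.exp (-(n / 8))) := by
    intro x
    have hcard : ∑ v, (G v).indicator (fun _ => (1 : ℝ≥0∞)) x =
        ((Finset.univ.filter fun v => x ∈ G v).card : ℝ≥0∞) := by
      simp [Set.indicator_apply]
    rw [hcard]
    rcases (Finset.univ.filter fun v => x ∈ G v).eq_empty_or_nonempty with hempty | ⟨v', hv'⟩
    · simp [hempty]
    · have hsub : (Finset.univ.filter fun v => x ∈ G v) ⊆
          Finset.univ.filter fun v : Fin n → Bool => (n : ℝ) / 2 < correlation v v' := by
        intro v hv
        simp only [Finset.mem_filter, Finset.mem_univ, true_and] at hv hv' ⊢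
        exact correlation_gt_of_mem_goodEvent hn hcs hc hs hε hv hv'
      rw [← ENNReal.ofReal_natCast]
      refine ENNReal.ofReal_le_ofReal (le_trans ?_ (card_correlation_gt_le v'))
      exact_mod_cast Finset.card_le_card hsub
  have hsum : ENNReal.ofReal (2 ^ n * m) ≤ ENNReal.ofReal (2 ^ n * Real.exp (-(n / 8))) := by
    calc ENNReal.ofReal (2 ^ n * m) = ∑ _v : Fin n → Bool, ENNReal.ofReal m := by
          rw [Finset.sum_const, Finset.card_univ, nsmul_eq_mul, ENNReal.ofReal_mul (by positivity),
            ← ENNReal.ofReal_natCast]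
          simp
      _ ≤ ∑ v, μ (G v) := Finset.sum_le_sum fun v _ => h v
      _ = ∫⁻ x, ∑ v, (G v).indicator (fun _ => (1 : ℝ≥0∞)) x ∂μ := by
          rw [lintegral_finsetSum _ fun v _ =>
            measurable_const.indicator (measurableSet_goodEvent hAhat _ _)]
          exact Finset.sum_congr rfl fun v _ =>
            (lintegral_indicator_one (measurableSet_goodEvent hAhat _ _)).symm
      _ ≤ ∫⁻ _, ENNReal.ofReal (2 ^ n * Real.exp (-(n / 8))) ∂μ := lintegral_mono hcount
      _ = _ := by rw [lintegral_const, measure_univ, mul_one]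
  have := (ENNReal.ofReal_le_ofReal_iff (by positivity)).1 hsum
  exact le_of_mul_le_mul_left this (by positivity)

end Packing

end LDS

end

/-! ### Choice of constants and the two regimes. -/

theorem theorem2 :
    ∃ c₀ : ℝ, 0 < c₀ ∧
      ∀ (d : ℕ) (ρ δ ε σ : ℝ), 2 ≤ d → 0 < δ → δ < 1 / 4 → 0 < ε → ε ≤ |ρ| / 2048 → 0 < σ →
        ∀ (T : ℕ) (Ahat : (Fin (T + 1) → LDS.State d) → Matrix (Fin d) (Fin d) ℝ),
          (∀ i j : Fin d, Measurable fun x => Ahat x i j) →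
          (T : ℝ) * LDS.scalarGramian T ρ ≤ c₀ * ((d : ℝ) + Real.log (1 / δ)) / ε ^ 2 →
          ENNReal.ofReal δ ≤
            ⨆ O : Matrix.orthogonalGroup (Fin d) ℝ,
              LDS.trajectoryLaw σ (ρ • (O : Matrix (Fin d) (Fin d) ℝ)) T
                {x | ε ≤ LDS.opNorm (Ahat x - ρ • (O : Matrix (Fin d) (Fin d) ℝ))} := by
  refine ⟨1 / 10 ^ 7, by norm_num, ?_⟩
  intro d ρ δ ε σ hd hδ hδ4 hε hερ hσ T Ahat hAhat hT
  by_contra! hlt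
  have herr : ∀ O : Matrix.orthogonalGroup (Fin d) ℝ,
      LDS.trajectoryLaw σ (ρ • (O : Matrix (Fin d) (Fin d) ℝ)) T
        {x | ε ≤ LDS.opNorm (Ahat x - ρ • (O : Matrix (Fin d) (Fin d) ℝ))} < ENNReal.ofReal δ :=
    fun O => (le_iSup _ O).trans_lt hlt
  obtain ⟨n, rfl⟩ : ∃ n, d = n + 1 := ⟨d - 1, by omega⟩
  have hn : n ≠ 0 := by omega
  have hρ : 0 < |ρ| := by linarith
  -- This scale makes weakly correlated alternatives `2ε`-separated, since `c ≥ 1/2`.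
  obtain ⟨s, hs⟩ : ∃ s, s = 2 * ε / |ρ| := ⟨_, rfl⟩
  have hs0 : 0 ≤ s := by rw [hs]; positivity
  have hρs : |ρ| * s = 2 * ε := by rw [hs]; field_simp
  have hs1 : s ≤ 1 / 2 := by
    rw [hs, div_le_iff₀ hρ]
    linarith
  obtain ⟨c, hc⟩ : ∃ c, c = √(1 - s ^ 2) := ⟨_, rfl⟩
  have hcs : c ^ 2 + s ^ 2 = 1 := by
    rw [hc, Real.sq_sqrt (by nlinarith)]
    ring
  have hc1 : 1 / 2 ≤ c := by
    rw [hc]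
    exact Real.le_sqrt_of_sq_le (by nlinarith)
  set L := Real.log (1 / δ) with hL
  have hδL : δ = Real.exp (-L) := by
    rw [hL, one_div, Real.log_inv, neg_neg, Real.exp_log hδ]
  have hlog2 := Real.log_two_lt_d9
  have hlog2' := Real.log_two_gt_d9
  have hL4 : 2 * Real.log 2 ≤ L := by
    have : Real.log 4 ≤ L := Real.log_le_log (by norm_num) (by
      rw [le_div_iff₀ hδ]
      linarith)
    have h4 : Real.log 4 = 2 * Real.log 2 := by
      rw [show (4 : ℝ) = 2 ^ 2 by norm_num, Real.log_pow]
      norm_num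
    linarith
  -- The factor `144` is `36 ρ² s² / ε²`.
  obtain ⟨K, hK⟩ : ∃ K : ℝ, K = 144 / 10 ^ 7 * (((n + 1 : ℕ) : ℝ) + L) := ⟨_, rfl⟩
  have hn0 : (1 : ℝ) ≤ n := by exact_mod_cast Nat.one_le_iff_ne_zero.2 hn
  push_cast at hK
  have hK0 : 0 < K := by
    rw [hK]
    have : 0 < L := by linarith
    positivity
  have hTK : T * LDS.scalarGramian T ρ * (36 * ρ ^ 2 * s ^ 2) ≤ K := by
    have h1 : ρ ^ 2 * s ^ 2 = 4 * ε ^ 2 := by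
      rw [← sq_abs, ← mul_pow, hρs]
      ring
    rw [le_div_iff₀ (by positivity)] at hT
    push_cast at hT
    rw [hK, mul_assoc 36, h1]
    nlinarith
  have hgood : ∀ v : Fin n → Bool,
      ENNReal.ofReal (Real.exp (-(124 * K + 1 / 10)) / 2) ≤
        LDS.trajectoryLaw σ (ρ • LDS.householder (LDS.baseVec n)) T
          (LDS.goodEvent Ahat ε (ρ • LDS.householder (LDS.signVec c s v))) := fun v =>
    LDS.le_trajectoryLaw_base_goodEvent hσ hn hcs (by linarith) hK0 hTK hAhat v
      (LDS.le_trajectoryLaw_goodEvent hAhat hδ4.le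
        (herr (LDS.reflection _ (LDS.norm_signVec hn hcs v))))
  have hhalf : Real.exp (-(124 * K + 1 / 10)) / 2 =
      Real.exp (-(124 * K + 1 / 10 + Real.log 2)) := by
    rw [neg_add _ (Real.log 2), Real.exp_add, Real.exp_neg (Real.log 2),
      Real.exp_log (by norm_num), div_eq_mul_inv]
  rw [hhalf] at hgood
  -- Up to the threshold, `124 K` is a small multiple of `L`, and `L ≥ 2 log 2` absorbs `1/10 + log
  -- 2`. Beyond it, `n + 1 > 26 log 2 > 18`, so `n/8` exceeds the whole exponent.
  rcases le_or_gt ((n : ℝ) + 1) (13 * L) with hsmall | hlarge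
  · have hsub : LDS.goodEvent Ahat ε (ρ • LDS.householder (LDS.signVec c s fun _ => true)) ⊆
        {x | ε ≤ LDS.opNorm (Ahat x - ρ • LDS.householder (LDS.baseVec n))} := by
      intro x hx
      by_contra hx'
      have hx0 : x ∈ LDS.goodEvent Ahat ε (ρ • LDS.householder (LDS.baseVec n)) := by
        simpa [LDS.goodEvent] using hx'
      have h1 := LDS.lt_of_mem_goodEvent hx hx0
      have h2 := LDS.le_opNorm_householder_sub_base (ρ := ρ) LDS.norm_baseVec
        (LDS.norm_signVec hn hcs fun _ => true) hs0 hcs (LDS.inner_signVec_baseVec c s _)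
      -- The base and the alternative are at least `2|ρ|s = 4ε` apart, so the estimate cannot be
      -- within `ε` of both.
      linarith
    have h1 := ((hgood fun _ => true).trans (measure_mono hsub)).trans_lt
      (herr (LDS.reflection _ LDS.norm_baseVec))
    rw [hδL, ENNReal.ofReal_lt_ofReal_iff (Real.exp_pos _), Real.exp_lt_exp] at h1
    linarith
  · have h1 := LDS.exists_trajectoryLaw_goodEvent_le hn hcs hc1 hs0 hρs.ge hAhat _
      hgood
    rw [Real.exp_le_exp] at h1
    have hn17 : (17 : ℝ) ≤ n := by linarith
    linarith
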